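/- Conventions. A constant-length directive sequence $\boldsymbol\theta=(\theta^{(n)})_{n\ge 0}$ with length sequence $(q_n)_{n\ge0}$, $q_n\ge 1$, consists of finite alphabets $\mathcal A_n$ and morphisms $\theta^{(n)}\colon \mathcal A_{n+1}\to\mathcal A_n^{q_n}$, extended to words and sequences by concatenation. Put $\theta^{[n,N)}=\theta^{(n)}\circ\cdots\circ\theta^{(N-1)}$. Let $X^{(n)}_{\boldsymbol\theta}\subseteq\mathcal A_n^{\mathbb Z}$ (respectively $\tilde X^{(n)}_{\boldsymbol\theta}\subseteq\mathcal A_n^{\mathbb N}$) be the set of two-sided (respectively one-sided) sequences all of whose subwords are subwords of some $\theta^{[n,N)}(a)$ with $N>n$, $a\in\mathcal A_N$. Put $X_{\boldsymbol\theta}=X^{(0)}_{\boldsymbol\theta}$, and let $\sigma$ denote the left shift. The sequence $\boldsymbol\theta$ is torsion-free if $q_n>1$ for infinitely many $n$, each $(X^{(n)}_{\boldsymbol\theta},\sigma)$ is (non-empty and) minimal, $X_{\boldsymbol\theta}$ contains no $\sigma$-periodic point, and each prime that divides some $q_k$ divides $q_n$ for infinitely many $n$. Let $\mathbb Z_{(q_n)}=\varprojlim_n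 \mathbb Z/(q_0\cdots q_{n-1})\mathbb Z$. A torsion-free $\boldsymbol\theta$ on alphabets of bounded size has height $h\ge 1$ if $h$ is coprime to every $q_n$ and the maximal equicontinuous factor of $(X_{\boldsymbol\theta},\sigma)$ is $(\mathbb Z_{(q_n)}\times\mathbb Z/h\mathbb Z,(+1,+1))$; the height is trivial if $h=1$. Pure base. Let $h\ge 1$ and let $(u^{(n)})_{n\ge0}$ be a sequence with $u^{(n)}\in\tilde X^{(n)}_{\boldsymbol\theta}$ and $\theta^{(n)}(u^{(n+1)})=u^{(n)}$ for all $n$ (for instance the right halves of a sequence $u^{(n)}\in X^{(n)}_{\boldsymbol\theta}$ that defines a two-sided limit word). Let $\mathcal W^{(n)}$ be the set of words $u^{(n)}_{kh}\cdots u^{(n)}_{(k+1)h-1}$, $k\ge0$, let $\mathcal B^{(n)}$ be an alphabet that codes $\mathcal W^{(n)}$ bijectively, let $\bar\tau_n\colon\mathcal B^{(n)}\to\mathcal W^{(n)}$ be the decoding map and $\tau_n$ its inverse, both extended by concatenation. The pure base $\boldsymbol{\bar\theta}=(\bar\theta^{(n)})_{n\ge0}$ is given by $\bar\theta^{(n)}\colon\mathcal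 B^{(n+1)}\to(\mathcal B^{(n)})^{q_n}$, $\bar\theta^{(n)}(b)=\tau_n(\theta^{(n)}(\bar\tau_{n+1}(b)))$. Theorem. Let $\boldsymbol\theta$ be a torsion-free directive sequence on alphabets of bounded size, of height $h$, and let $\boldsymbol{\bar\theta}$ be its pure base defined by $h$ and any sequence $(u^{(n)})$ as above. Then $\boldsymbol{\bar\theta}$ is a torsion-free directive sequence on alphabets of bounded size, it has trivial height, and $(X_{\boldsymbol\theta},\sigma)$ is topologically conjugate to $(X_{\boldsymbol{\bar\theta}}\times\{0,\dots,h-1\},T)$, where $T(x,i)=(x,i+1)$ if $0\le i<h-1$ and $T(x,h-1)=(\bar\sigma(x),0)$, with $\bar\sigma$ the left shift on $X_{\boldsymbol{\bar\theta}}$. -/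

import Mathlib

universe u v

/-! ## Constant-length directive sequences and their shifts -/

/-- A constant-length directive sequence: finite alphabets `A n`, positive lengths `q n`, and
morphisms `θ⁽ⁿ⁾ : A (n+1) → (A n)^(q n)`, where `mor n a j` is the `j`-th letter of `θ⁽ⁿ⁾(a)`. -/
structure DirectiveSeq where
  A : ℕ → Type u
  finite_A : ∀ n, Finite (A n)
  q : ℕ → ℕ
  q_pos : ∀ n, 0 < q n
  mor : ∀ n, A (n + 1) → Fin (q n) → A n

/-- The left shift on two-sided sequences. -/
def leftShift {α : Type u} (x : ℤ → α) : ℤ → α := fun k => x (k + 1)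

namespace DirectiveSeq

variable (θ : DirectiveSeq.{u})

/-- Alphabets carry the discrete topology, and `ℤ → A n` the product topology. -/
instance (n : ℕ) : TopologicalSpace (θ.A n) := ⊥

instance (n : ℕ) : DiscreteTopology (θ.A n) := ⟨rfl⟩

instance (n : ℕ) : Finite (θ.A n) := θ.finite_A n

/-- The cardinalities of the alphabets are bounded. -/
def BoundedAlphabets : Prop := ∃ C : ℕ, ∀ n, Nat.card (θ.A n) ≤ C

/-- `θ⁽ⁿ⁾` extended to finite words by concatenation. -/
def morWord (n : ℕ) (w : List (θ.A (n + 1))) : List (θ.A n) :=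
  w.flatMap fun a => List.ofFn (θ.mor n a)

/-- `θ⁽ⁿ⁾` extended to right-infinite sequences by concatenation. -/
def morSeq (n : ℕ) (x : ℕ → θ.A (n + 1)) : ℕ → θ.A n :=
  fun m => θ.mor n (x (m / θ.q n)) ⟨m % θ.q n, Nat.mod_lt _ (θ.q_pos n)⟩

/-- The composition `θ⁽ⁿ⁾ ∘ θ⁽ⁿ⁺¹⁾ ∘ ⋯ ∘ θ⁽ⁿ⁺ᵏ⁻¹⁾` on finite words. -/
def comp (n : ℕ) : (k : ℕ) → List (θ.A (n + k)) → List (θ.A n)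
  | 0 => fun w => w
  | k + 1 => fun w => comp n k (θ.morWord (n + k) w)

/-- The level-`n` language: all subwords of the words `θ^[n,N)(a)` with `N > n` and `a ∈ A N`
(here `N = n + k` with `k ≥ 1`). -/
def lang (n : ℕ) : Set (List (θ.A n)) :=
  {w | ∃ k : ℕ, 0 < k ∧ ∃ a : θ.A (n + k), w <:+: θ.comp n k [a]}

/-- The level-`n` two-sided shift `X⁽ⁿ⁾`: all subwords `x_k ⋯ x_{k+ℓ-1}` lie in the language. -/
def X (n : ℕ) : Set (ℤ → θ.A n) :=
  {x | ∀ (k : ℤ) (l : ℕ), List.ofFn (fun i : Fin l => x (k + (i : ℤ))) ∈ θ.lang n}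

/-- The level-`n` one-sided shift. -/
def XOne (n : ℕ) : Set (ℕ → θ.A n) :=
  {x | ∀ k l : ℕ, List.ofFn (fun i : Fin l => x (k + (i : ℕ))) ∈ θ.lang n}

theorem leftShift_mem (n : ℕ) {x : ℤ → θ.A n} (hx : x ∈ θ.X n) : leftShift x ∈ θ.X n := by
  intro k l
  have h := hx (k + 1) l
  have e : (fun i : Fin l => leftShift x (k + (i : ℤ))) =
      fun i : Fin l => x (k + 1 + (i : ℤ)) := by
    funext i
    simp only [leftShift]
    congr 1
    ring
  rw [e]
  exact h

/-- The shift map `σ : X⁽ⁿ⁾ → X⁽ⁿ⁾`. -/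
def shiftMap (n : ℕ) (x : θ.X n) : θ.X n := ⟨leftShift x.1, θ.leftShift_mem n x.2⟩

/-- `(X⁽ⁿ⁾, σ)` is minimal: it is non-empty and its only non-empty closed shift-invariant
subset is itself. -/
def IsMinimalAt (n : ℕ) : Prop :=
  (θ.X n).Nonempty ∧
    ∀ C : Set (ℤ → θ.A n), IsClosed C → C ⊆ θ.X n → C.Nonempty →
      (∀ x ∈ C, leftShift x ∈ C) → C = θ.X n

/-- No point of `X⁽⁰⁾` is shift-periodic. -/
def IsAperiodic : Prop :=
  ∀ x ∈ θ.X 0, ∀ k : ℕ, 0 < k → leftShift^[k] x ≠ x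

/-- Torsion-free directive sequences. -/
structure IsTorsionFree : Prop where
  length_gt_one : ∀ m, ∃ n, m ≤ n ∧ 1 < θ.q n
  minimal : ∀ n, θ.IsMinimalAt n
  aperiodic : θ.IsAperiodic
  prime_dvd : ∀ p : ℕ, p.Prime → ∀ k, p ∣ θ.q k → ∀ m, ∃ n, m ≤ n ∧ p ∣ θ.q n

end DirectiveSeq

/-! ## Odometers -/

/-- `p_n = q_0 q_1 ⋯ q_{n-1}`. -/
def partialProd (q : ℕ → ℕ) (n : ℕ) : ℕ := ∏ i ∈ Finset.range n, q i

theorem partialProd_dvd (q : ℕ → ℕ) (n : ℕ) : partialProd q n ∣ partialProd q (n + 1) :=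
  ⟨q n, Finset.prod_range_succ q n⟩

/-- The group `ℤ_(q_n)`, as the inverse limit of the cyclic groups `ℤ/p_nℤ`, with the topology
induced by the product of the discrete topologies. -/
def odometer (q : ℕ → ℕ) : AddSubgroup (∀ n, ZMod (partialProd q n)) where
  carrier := {z | ∀ n, ZMod.castHom (partialProd_dvd q n) (ZMod (partialProd q n)) (z (n + 1)) = z n}
  zero_mem' := fun n => by simp
  add_mem' := fun {a b} ha hb n => by
    have h1 := ha n
    have h2 := hb n
    simp only [Pi.add_apply, map_add] at *
    rw [h1, h2]
  neg_mem' := fun {a} ha n => by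
    have h1 := ha n
    simp only [Pi.neg_apply, map_neg] at *
    rw [h1]

/-- The topological generator `1` of the odometer. -/
def odometerOne (q : ℕ → ℕ) : odometer q :=
  ⟨fun _ => 1, fun n => map_one (ZMod.castHom (partialProd_dvd q n) (ZMod (partialProd q n)))⟩

/-- The homeomorphism `(+1, +1)` of `ℤ_(q_n) × ℤ/hℤ`. -/
def odometerRotation (q : ℕ → ℕ) (h : ℕ) : (odometer q × ZMod h) ≃ₜ (odometer q × ZMod h) :=
  Homeomorph.addRight (odometerOne q, 1)

/-! ## Maximal equicontinuous factors -/

/-- `(Z, S)` is equicontinuous: the family `{S^k : k ∈ ℤ}` is equicontinuous, for a uniform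
structure inducing the topology of `Z` (which is unique when `Z` is compact Hausdorff, as all
factors below are). -/
def IsEquicontinuousSystem {Z : Type v} [t : TopologicalSpace Z] (S : Z ≃ₜ Z) : Prop :=
  ∃ U : UniformSpace Z, U.toTopologicalSpace = t ∧
    @Equicontinuous ℤ Z Z t U (fun k => ⇑(S ^ k))

/-- `π : (X, T) → (Z, S)` is a factor map: a continuous surjection with `π ∘ T = S ∘ π`. -/
structure IsFactorMap {X : Type u} {Z : Type v} [TopologicalSpace X] [TopologicalSpace Z]
    (T : X → X) (S : Z → Z) (π : X → Z) : Prop where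
  continuous : Continuous π
  surjective : Function.Surjective π
  equivariant : ∀ x, π (T x) = S (π x)

/-- `π : (X, T) → (Z, S)` is a maximal equicontinuous factor of the compact system `(X, T)`:
`(Z, S)` is an equicontinuous Hausdorff factor, and every other equicontinuous Hausdorff factor of
`(X, T)` factors through it. (Every such factor of `X` is homeomorphic to a quotient of `X`,
so testing against spaces in the universe of `X` loses nothing.) -/
structure IsMaximalEquicontinuousFactor {X : Type u} {Z : Type v} [TopologicalSpace X]
    [TopologicalSpace Z] (T : X → X) (S : Z ≃ₜ Z) (π : X → Z) : Prop where
  t2 : T2Space Z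
  factor : IsFactorMap T S π
  equicontinuous : IsEquicontinuousSystem S
  maximal : ∀ (Y : Type u) [TopologicalSpace Y] [T2Space Y] (R : Y ≃ₜ Y) (ρ : X → Y),
    IsFactorMap T R ρ → IsEquicontinuousSystem R →
      ∃ g : Z → Y, IsFactorMap S R g ∧ ∀ x, ρ x = g (π x)

namespace DirectiveSeq

variable (θ : DirectiveSeq.{u})

/-- `h` is the height of `θ`: `h ≥ 1` is coprime to every length `q_n`, and the maximal
equicontinuous factor of `(X_θ, σ)` is `(ℤ_(q_n) × ℤ/hℤ, (+1, +1))`. -/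
def HasHeight (h : ℕ) : Prop :=
  0 < h ∧ (∀ n, Nat.Coprime h (θ.q n)) ∧
    ∃ π : θ.X 0 → odometer θ.q × ZMod h,
      IsMaximalEquicontinuousFactor (θ.shiftMap 0) (odometerRotation θ.q h) π

/-! ## The pure base -/

/-- The sequences `(u⁽ⁿ⁾)` defining limit words: `u⁽ⁿ⁾` lies in the one-sided level-`n` shift and
`θ⁽ⁿ⁾(u⁽ⁿ⁺¹⁾) = u⁽ⁿ⁾`. If `(u⁽ⁿ⁾)` defines a two-sided limit word, then the right halves
`u⁽ⁿ⁾_0 u⁽ⁿ⁾_1 ⋯` form such a sequence; the pure base only depends on the right halves. -/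
structure IsLimitSequence (u : ∀ n, ℕ → θ.A n) : Prop where
  mem : ∀ n, u n ∈ θ.XOne n
  map_eq : ∀ n, θ.morSeq n (u (n + 1)) = u n

/-- `W⁽ⁿ⁾`: the words of length `h` that occur in `u⁽ⁿ⁾` at the indices `kh`, `k ≥ 0`. -/
def blocks (h : ℕ) (u : ∀ n, ℕ → θ.A n) (n : ℕ) : Set (Fin h → θ.A n) :=
  {w | ∃ k : ℕ, w = fun i : Fin h => u n (k * h + i)}

theorem block_index_lt {q h : ℕ} (j : Fin q) (i : Fin h) : (j * h + i : ℕ) < h * q := by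
  have h1 : (j + 1 : ℕ) * h ≤ q * h := Nat.mul_le_mul_right h j.2
  have h2 := i.2
  nlinarith

/-- The `m`-th letter of the word `θ⁽ⁿ⁾(w)` of length `h * q n`, for a word `w` of length `h`. -/
def morBlock (n h : ℕ) (w : Fin h → θ.A (n + 1)) (m : Fin (h * θ.q n)) : θ.A n :=
  θ.mor n (w ⟨m / θ.q n, Nat.div_lt_of_lt_mul (lt_of_lt_of_eq m.2 (Nat.mul_comm _ _))⟩)
    ⟨m % θ.q n, Nat.mod_lt _ (θ.q_pos n)⟩

/-- The `j`-th of the `q n` consecutive blocks of length `h` of `θ⁽ⁿ⁾(w)`. -/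
def subBlock (n h : ℕ) (w : Fin h → θ.A (n + 1)) (j : Fin (θ.q n)) : Fin h → θ.A n :=
  fun i => θ.morBlock n h w ⟨j * h + i, block_index_lt j i⟩

theorem subBlock_mem (h : ℕ) (u : ∀ n, ℕ → θ.A n) (hu : θ.IsLimitSequence u) (n : ℕ)
    {w : Fin h → θ.A (n + 1)} (hw : w ∈ θ.blocks h u (n + 1)) (j : Fin (θ.q n)) :
    θ.subBlock n h w j ∈ θ.blocks h u n := by
  obtain ⟨k, rfl⟩ := hw
  refine ⟨k * θ.q n + j, ?_⟩
  funext i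
  have e : (k * θ.q n + j) * h + i = (j * h + i) + θ.q n * (k * h) := by ring
  have h1 : ((k * θ.q n + j) * h + i) / θ.q n = k * h + (j * h + i) / θ.q n := by
    rw [e, Nat.add_mul_div_left _ _ (θ.q_pos n), Nat.add_comm]
  have h2 : ((k * θ.q n + j) * h + i) % θ.q n = (j * h + i) % θ.q n := by
    rw [e, Nat.add_mul_mod_self_left]
  rw [← hu.map_eq n]
  simp only [subBlock, morBlock, morSeq, h1, h2]

/-- The pure base of `θ` defined by the sequence `u`, with block length `h`: its `n`-th alphabet
is `W⁽ⁿ⁾` (each word being its own code), its length sequence is `q`, and its `n`-th morphism maps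
`w ∈ W⁽ⁿ⁺¹⁾` to `θ⁽ⁿ⁾(w)`, read as a sequence of `q n` blocks in `W⁽ⁿ⁾`. -/
def pureBase (h : ℕ) (u : ∀ n, ℕ → θ.A n) (hu : θ.IsLimitSequence u) : DirectiveSeq.{u} where
  A n := θ.blocks h u n
  finite_A _ := inferInstance
  q := θ.q
  q_pos := θ.q_pos
  mor n w j := ⟨θ.subBlock n h w.1 j, θ.subBlock_mem h u hu n w.2 j⟩

end DirectiveSeq

/-! ## Constant-height suspensions -/

/-- The suspension of `T : X → X` of constant height `h`: the map on `X × {0, …, h-1}` sending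
`(x, i)` to `(x, i+1)` if `i < h - 1` and to `(T x, 0)` if `i = h - 1`. -/
def suspension {X : Type u} (T : X → X) (h : ℕ) (p : X × Fin h) : X × Fin h :=
  if hi : (p.2 : ℕ) + 1 < h then (p.1, ⟨p.2 + 1, hi⟩)
  else (T p.1, ⟨0, lt_of_le_of_lt (Nat.zero_le _) p.2.2⟩)

/-! ## Two-sided shifts generated by one-sided sequences -/

section ShiftSpaces

open Filter Topology

variable {α β : Type u}

/-! Write X̄ for the shift of the pure base and D for decoding, extended to two-sided sequences. By
minimality, X⁽ⁿ⁾ consists of the sequences whose subwords occur in u⁽ⁿ⁾. The level-n shift of the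
pure base is described in the same way by u⁽ⁿ⁾ read in blocks of length h, because every block
occurs there and the products of lengths are unbounded. Hence D maps X̄ into X, and D ∘ σ̄ = σ^h ∘
D.

The height gives a continuous F : X → ℤ/h with F ∘ σ = F + 1. Since F depends on a finite window, it
can be read along u, far enough to the right, where it grows by one per step. Points of D(X̄) are
approximated by u at positions divisible by h, so F is constant on D(X̄). Therefore the sets σ^i
D(X̄), 0 ≤ i < h, are disjoint. Their union is closed and invariant, hence all of X. As D is
injective, (x, i) ↦ σ^i D(x) is the conjugacy. The same argument for a closed invariant subset of X̄
shows that X̄ is minimal; at higher levels F is transported through θ⁽ⁿ⁾, which is possible because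
q_n is invertible modulo h.

For trivial height, an equicontinuous factor of X̄ suspends to one of X, hence factors through
ℤ_(q_n) × ℤ/h. Over the fibre of ℤ/h that contains D(X̄), the map σ^h acts on ℤ_(q_n) as translation
by h, and division by h turns this into +1. -/

theorem leftShift_iterate (x : ℤ → α) (i : ℕ) : leftShift^[i] x = fun k => x (k + i) := by
  induction i with
  | zero => simp
  | succ i ih =>
    rw [Function.iterate_succ_apply', ih]
    funext k
    simp only [leftShift]
    congr 1
    push_cast
    ring

theorem leftShift_iterate_injective (i : ℕ) :
    Function.Injective (leftShift^[i] : (ℤ → α) → ℤ → α) := by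
  intro x y hxy
  simp only [leftShift_iterate] at hxy
  funext k
  simpa using congrFun hxy (k - i)

theorem continuous_leftShift_iterate [TopologicalSpace α] (i : ℕ) :
    Continuous (leftShift^[i] : (ℤ → α) → ℤ → α) := by
  have h : (leftShift^[i] : (ℤ → α) → ℤ → α) = fun x k => x (k + i) :=
    funext fun x => leftShift_iterate x i
  rw [h]
  fun_prop

/-- The two-sided sequences all of whose subwords occur in the one-sided sequence `v`. -/
def shiftOf (v : ℕ → α) : Set (ℤ → α) :=
  {x | ∀ (k : ℤ) (l : ℕ), ∃ m : ℕ, ∀ i < l, x (k + (i : ℤ)) = v (m + i)}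

theorem leftShift_mem_shiftOf {v : ℕ → α} {x : ℤ → α} (hx : x ∈ shiftOf v) :
    leftShift x ∈ shiftOf v := by
  intro k l
  obtain ⟨m, hm⟩ := hx (k + 1) l
  refine ⟨m, fun i hi => ?_⟩
  rw [← hm i hi]
  simp only [leftShift]
  congr 1
  ring

/-- The `m`-th shift of the extension of `v` to `ℤ` that repeats `v 0` on the left. -/
def shiftedExtension (v : ℕ → α) (m : ℕ) : ℤ → α := fun j => v (j + m).toNat

/-- Locating a window with M further letters on its left forces its centre to lie at distance at
least M + R from the origin of `v`. The artificial left half is then never seen. -/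
theorem exists_eqOn_shiftedExtension {v : ℕ → α} {x : ℤ → α} (hx : x ∈ shiftOf v) (R M : ℕ) :
    ∃ m, M + R ≤ m ∧ Set.EqOn x (shiftedExtension v m) (Set.Icc (-R : ℤ) R) := by
  obtain ⟨m, hm⟩ := hx (-(R + M : ℕ)) (2 * R + M + 1)
  refine ⟨m + (R + M), by omega, fun j hj => ?_⟩
  obtain ⟨h1, h2⟩ := hj
  have h3 := hm (j + (R + M : ℕ)).toNat (by omega)
  have e1 : (-((R + M : ℕ) : ℤ) + ((j + (R + M : ℕ)).toNat : ℤ)) = j := by omega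
  have e2 : (m + (j + (R + M : ℕ)).toNat) = (j + (m + (R + M) : ℕ)).toNat := by omega
  rw [e1, e2] at h3
  exact h3

theorem mem_shiftOf_of_forall_eqOn {v : ℕ → α} {x : ℤ → α}
    (hx : ∀ R : ℕ, ∃ m, R ≤ m ∧ Set.EqOn x (shiftedExtension v m) (Set.Icc (-R : ℤ) R)) :
    x ∈ shiftOf v := by
  intro k l
  obtain ⟨m, hm, h⟩ := hx (k.natAbs + l)
  refine ⟨(k + m).toNat, fun i hi => ?_⟩
  rw [h ⟨by omega, by omega⟩]
  simp only [shiftedExtension]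
  congr 1
  omega

section Topology

variable [TopologicalSpace α]

theorem exists_eqOn_Icc_imp_mem {x : ℤ → α} {s : Set (ℤ → α)} (hs : s ∈ 𝓝 x) :
    ∃ R : ℕ, ∀ y, Set.EqOn y x (Set.Icc (-R : ℤ) R) → y ∈ s := by
  rw [nhds_pi, Filter.mem_pi] at hs
  obtain ⟨I, hI, t, ht, hts⟩ := hs
  obtain ⟨R, hR⟩ := (hI.image Int.natAbs).bddAbove
  refine ⟨R, fun y hy => hts fun j hj => ?_⟩
  have h1 : j.natAbs ≤ R := hR ⟨j, hj, rfl⟩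
  rw [hy ⟨by omega, by omega⟩]
  exact mem_of_mem_nhds (ht j)

variable [DiscreteTopology α]

theorem eventually_eqOn_Icc (x : ℤ → α) (R : ℕ) :
    ∀ᶠ y in 𝓝 x, Set.EqOn y x (Set.Icc (-R : ℤ) R) := by
  have h : ∀ᶠ y in 𝓝 x, ∀ j ∈ Set.Icc (-R : ℤ) R, y j = x j := by
    rw [Filter.eventually_all_finite (Set.finite_Icc _ _)]
    intro j _
    have := (continuous_apply (A := fun _ : ℤ => α) j).tendsto x
    rw [nhds_discrete α] at this
    exact tendsto_pure.1 this
  exact h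

theorem mem_shiftOf_of_mapClusterPt {v : ℕ → α} {x : ℤ → α}
    (hx : MapClusterPt x atTop (shiftedExtension v)) : x ∈ shiftOf v := by
  refine mem_shiftOf_of_forall_eqOn fun R => ?_
  obtain ⟨m, hm, h⟩ := ((hx.frequently (eventually_eqOn_Icc x R)).and_eventually
    (eventually_ge_atTop R)).exists
  exact ⟨m, h, hm.symm⟩

theorem isClosed_shiftOf (v : ℕ → α) : IsClosed (shiftOf v) := by
  refine isClosed_of_closure_subset fun x hx => ?_
  intro k l
  obtain ⟨y, hy, hyv⟩ := mem_closure_iff_nhds.1 hx _ (eventually_eqOn_Icc x (k.natAbs + l))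
  obtain ⟨m, hm⟩ := hyv k l
  exact ⟨m, fun i hi => by rw [← hm i hi, hy ⟨by omega, by omega⟩]⟩

/-- By compactness, a continuous map to a discrete space depends on finitely many coordinates. -/
theorem exists_window {γ : Type*} [TopologicalSpace γ] [DiscreteTopology γ] {K : Set (ℤ → α)}
    (hK : IsCompact K) {F : K → γ} (hF : Continuous F) :
    ∃ R : ℕ, ∀ x y : K, Set.EqOn x.1 y.1 (Set.Icc (-R : ℤ) R) → F x = F y := by
  have hloc : ∀ x : K, ∃ R : ℕ, ∀ y : K, Set.EqOn y.1 x.1 (Set.Icc (-R : ℤ) R) → F y = F x := by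
    intro x
    have h1 : F ⁻¹' {F x} ∈ 𝓝 x := hF.continuousAt.preimage_mem_nhds (by simp)
    rw [nhds_subtype, Filter.mem_comap] at h1
    obtain ⟨s, hs, hsF⟩ := h1
    obtain ⟨R, hR⟩ := exists_eqOn_Icc_imp_mem hs
    exact ⟨R, fun y hy => hsF (hR y.1 hy)⟩
  choose R hR using hloc
  have : CompactSpace K := isCompact_iff_compactSpace.1 hK
  obtain ⟨t, ht⟩ := CompactSpace.elim_nhds_subcover
    (fun x : K => {y : K | Set.EqOn y.1 x.1 (Set.Icc (-R x : ℤ) (R x))})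
    (fun x => continuous_subtype_val.continuousAt.eventually (eventually_eqOn_Icc x.1 (R x)))
  refine ⟨t.sup R, fun x y hxy => ?_⟩
  have hx : x ∈ (⊤ : Set K) := trivial
  rw [← ht] at hx
  simp only [Set.mem_iUnion, Set.mem_ofPred_eq, exists_prop] at hx
  obtain ⟨z, hz, hxz⟩ := hx
  have hle : (R z : ℤ) ≤ (t.sup R : ℕ) := by exact_mod_cast Finset.le_sup hz
  have hyz : Set.EqOn y.1 z.1 (Set.Icc (-R z : ℤ) (R z)) :=
    (hxy.symm.mono (Set.Icc_subset_Icc (by omega) hle)).trans hxz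
  rw [hR z x hxz, hR z y hyz]

variable [Finite α]

theorem isCompact_shiftOf (v : ℕ → α) : IsCompact (shiftOf v) :=
  (isClosed_shiftOf v).isCompact

theorem shiftOf_nonempty (v : ℕ → α) : (shiftOf v).Nonempty := by
  obtain ⟨x, hx⟩ := exists_clusterPt_of_compactSpace (map (shiftedExtension v) atTop)
  exact ⟨x, mem_shiftOf_of_mapClusterPt hx⟩

/-- Infinitely many exceptional `m` would accumulate at a point of `shiftOf v`, which agrees with
one of them on the window. Since `v` need not be recurrent, an initial segment has to be discarded.
-/
theorem eventually_exists_mem_shiftOf_eqOn (v : ℕ → α) (R : ℕ) :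
    ∃ M, ∀ m, M ≤ m →
      ∃ z ∈ shiftOf v, Set.EqOn z (shiftedExtension v m) (Set.Icc (-R : ℤ) R) := by
  rw [← Filter.eventually_atTop]
  by_contra hcon
  rw [Filter.not_eventually] at hcon
  obtain ⟨x, -, hx⟩ := (isCompact_univ (X := ℤ → α)).exists_mapClusterPt_of_frequently
    (f := shiftedExtension v) (l := atTop ⊓ 𝓟 {m | ¬ ∃ z ∈ shiftOf v,
      Set.EqOn z (shiftedExtension v m) (Set.Icc (-R : ℤ) R)})
    (by
      have : (atTop ⊓ 𝓟 {m | ¬ ∃ z ∈ shiftOf v,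
        Set.EqOn z (shiftedExtension v m) (Set.Icc (-R : ℤ) R)}).NeBot :=
        frequently_mem_iff_neBot.1 hcon
      exact Frequently.of_forall fun _ => Set.mem_univ _)
  have hxv : x ∈ shiftOf v := mem_shiftOf_of_mapClusterPt (hx.mono inf_le_left)
  obtain ⟨m, h1, h2⟩ := ((hx.frequently (eventually_eqOn_Icc x R)).and_eventually
    (Filter.mem_inf_of_right (mem_principal_self _))).exists
  exact h2 ⟨x, hxv, h1.symm⟩

end Topology

/-! ## Constant-length substitutions on two-sided sequences -/

/-- The substitution `s : β → α^q`, extended to two-sided sequences by concatenation. -/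
def substSeq {q : ℕ} (hq : 0 < q) (s : β → Fin q → α) (x : ℤ → β) : ℤ → α :=
  fun m => s (x (m / q)) ⟨(m % q).toNat, by
    have h1 := Int.emod_nonneg m (b := q) (by omega)
    have h2 := Int.emod_lt_of_pos m (b := q) (by omega)
    omega⟩

section Subst

variable {q : ℕ} (hq : 0 < q) (s : β → Fin q → α)

theorem substSeq_apply_mul_add (x : ℤ → β) (k : ℤ) (i : Fin q) :
    substSeq hq s x (k * q + (i : ℕ)) = s (x k) i := by
  have hi := i.2
  have e1 : (k * q + (i : ℕ)) / (q : ℤ) = k := by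
    rw [add_comm, Int.add_mul_ediv_right _ _ (by omega), Int.ediv_eq_zero_of_lt (by omega)
      (by omega), zero_add]
  have e2 : ((k * q + (i : ℕ)) % (q : ℤ)).toNat = i := by
    rw [add_comm, Int.add_mul_emod_self_right, Int.emod_eq_of_lt (by omega) (by omega)]
    simp
  simp only [substSeq, e1, e2]

theorem substSeq_injective (hs : Function.Injective s) :
    Function.Injective (substSeq hq s) := by
  intro x y hxy
  funext k
  apply hs
  funext i
  rw [← substSeq_apply_mul_add hq s x, hxy, substSeq_apply_mul_add]

theorem substSeq_leftShift (x : ℤ → β) :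
    substSeq hq s (leftShift x) = leftShift^[q] (substSeq hq s x) := by
  rw [leftShift_iterate]
  funext m
  have e1 : (m + q) / (q : ℤ) = m / q + 1 := Int.add_ediv_of_dvd_right (dvd_refl _) |>.trans (by
    rw [Int.ediv_self (by omega)])
  have e2 : (m + q) % (q : ℤ) = m % q := Int.add_emod_right _ _
  simp only [substSeq, leftShift, e1, e2]

theorem continuous_substSeq [TopologicalSpace α] [TopologicalSpace β] [DiscreteTopology β] :
    Continuous (substSeq hq s) := by
  refine continuous_pi fun m => ?_
  exact (continuous_of_discreteTopology (f := fun b : β => s b _)).comp (continuous_apply (m / q))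

variable {s} {w : ℕ → β} {v : ℕ → α}

/-- The same radius serves on both sides, because |j| ≤ R implies |⌊j/q⌋| ≤ R. -/
theorem substSeq_eqOn
    (hv : ∀ m, v m = s (w (m / q)) ⟨m % q, Nat.mod_lt _ hq⟩)
    {x : ℤ → β} {R m : ℕ} (hm : R ≤ m)
    (hx : Set.EqOn x (shiftedExtension w m) (Set.Icc (-R : ℤ) R)) :
    Set.EqOn (substSeq hq s x) (shiftedExtension v (m * q)) (Set.Icc (-R : ℤ) R) := by
  rintro j ⟨h1, h2⟩
  have hqz : (0 : ℤ) < q := by exact_mod_cast hq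
  have hle : (-R : ℤ) ≤ j / q := by
    rw [Int.le_ediv_iff_mul_le hqz]
    nlinarith
  have hge : j / q ≤ (R : ℤ) := by
    rcases le_or_gt 0 j with hj | hj
    · exact (Int.ediv_le_self _ hj).trans h2
    · exact (Int.ediv_neg_of_neg_of_pos hj hqz).le.trans (by omega)
  have hnn : 0 ≤ j + ((m * q : ℕ) : ℤ) := by push_cast; nlinarith
  obtain ⟨N, hN⟩ := Int.eq_ofNat_of_zero_le hnn
  have e1 : N / q = (j / q + m).toNat := by
    have : ((N / q : ℕ) : ℤ) = j / q + m := by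
      rw [Int.natCast_div, ← hN]
      push_cast
      rw [Int.add_mul_ediv_right _ _ hqz.ne']
    omega
  have e2 : N % q = (j % q).toNat := by
    have : ((N % q : ℕ) : ℤ) = j % q := by
      rw [Int.natCast_mod, ← hN]
      push_cast
      rw [Int.add_mul_emod_self_right]
    omega
  simp only [shiftedExtension, hN, Int.toNat_natCast, hv, e1, e2, substSeq]
  rw [hx ⟨hle, hge⟩, shiftedExtension]

theorem exists_substSeq_eqOn
    (hv : ∀ m, v m = s (w (m / q)) ⟨m % q, Nat.mod_lt _ hq⟩)
    {x : ℤ → β} (hx : x ∈ shiftOf w) (R M : ℕ) :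
    ∃ m, M + R ≤ m ∧
      Set.EqOn (substSeq hq s x) (shiftedExtension v (m * q)) (Set.Icc (-R : ℤ) R) := by
  obtain ⟨m, hm, h⟩ := exists_eqOn_shiftedExtension hx R M
  exact ⟨m, hm, substSeq_eqOn hq hv (by omega) h⟩

theorem substSeq_mem_shiftOf
    (hv : ∀ m, v m = s (w (m / q)) ⟨m % q, Nat.mod_lt _ hq⟩)
    {x : ℤ → β} (hx : x ∈ shiftOf w) :
    substSeq hq s x ∈ shiftOf v := by
  refine mem_shiftOf_of_forall_eqOn fun R => ?_
  obtain ⟨m, hm, h⟩ := exists_substSeq_eqOn hq hv hx R 0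
  exact ⟨m * q, by nlinarith, h⟩

end Subst

end ShiftSpaces

/-! ### Eigenfunctions for `h`-th roots of unity, and minimality of the decoded shift -/

section HeightFunctions

open Filter Topology

variable {α β : Type u} {h : ℕ} {v : ℕ → α} {w : ℕ → β}

theorem leftShift_iterate_mem {K : Set (ℤ → α)} (hK : ∀ x ∈ K, leftShift x ∈ K) (i : ℕ)
    {x : ℤ → α} (hx : x ∈ K) : leftShift^[i] x ∈ K := by
  induction i with
  | zero => exact hx
  | succ i ih =>
    rw [Function.iterate_succ_apply']
    exact hK _ ih

/-- `F : K → ℤ/hℤ` is a continuous map that conjugates the shift to `+1`, that is, a continuous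
eigenfunction of the shift-invariant set `K` for an `h`-th root of unity. -/
structure IsHeightFunction [TopologicalSpace α] (K : Set (ℤ → α)) (F : K → ZMod h) : Prop where
  continuous : Continuous F
  map_leftShift : ∀ x y : K, y.1 = leftShift x.1 → F y = F x + 1

theorem IsHeightFunction.map_iterate [TopologicalSpace α] {K : Set (ℤ → α)} {F : K → ZMod h}
    (hF : IsHeightFunction K F) (hK : ∀ x ∈ K, leftShift x ∈ K) (i : ℕ) (x y : K)
    (hxy : y.1 = leftShift^[i] x.1) : F y = F x + i := by
  induction i generalizing y with
  | zero => simp [Subtype.ext hxy]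
  | succ i ih =>
    rw [Function.iterate_succ_apply'] at hxy
    rw [hF.map_leftShift ⟨_, leftShift_iterate_mem hK i x.2⟩ y hxy, ih _ rfl]
    push_cast
    ring

/-- One shift of `x` becomes `q` shifts of its image, so `F` grows by `q`; dividing by `q`, a unit
modulo `h`, restores growth by one. -/
theorem IsHeightFunction.pullback [TopologicalSpace α] [TopologicalSpace β] [DiscreteTopology β]
    {F : shiftOf v → ZMod h} (hF : IsHeightFunction (shiftOf v) F) {q : ℕ} (hq : 0 < q)
    (hqh : Nat.Coprime q h) {s : β → Fin q → α}
    (hv : ∀ m, v m = s (w (m / q)) ⟨m % q, Nat.mod_lt _ hq⟩) :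
    IsHeightFunction (shiftOf w) fun x => (q : ZMod h)⁻¹ *
      F ⟨substSeq hq s x.1, substSeq_mem_shiftOf hq hv x.2⟩ where
  continuous := continuous_const.mul (hF.continuous.comp
    (((continuous_substSeq hq s).comp continuous_subtype_val).subtype_mk _))
  map_leftShift x y hxy := by
    rw [hF.map_iterate (fun _ hx => leftShift_mem_shiftOf hx) q
      ⟨substSeq hq s x.1, substSeq_mem_shiftOf hq hv x.2⟩
      ⟨substSeq hq s y.1, substSeq_mem_shiftOf hq hv y.2⟩
      ((congrArg _ hxy).trans (substSeq_leftShift hq s x.1)), mul_add,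
      mul_comm _ (q : ZMod h), ZMod.coe_mul_inv_eq_one q hqh]

/-- `F` can be evaluated along `v` by points of the shift that look like `v` near a given position.
Its value then depends on the position modulo `h` only, and decoded points look like `v` at
multiples of `h`. -/
theorem IsHeightFunction.exists_const [TopologicalSpace α] [DiscreteTopology α] [Finite α]
    {F : shiftOf v → ZMod h} (hF : IsHeightFunction (shiftOf v) F) (hh : 0 < h)
    {s : β → Fin h → α} (hv : ∀ m, v m = s (w (m / h)) ⟨m % h, Nat.mod_lt _ hh⟩) :
    ∃ c, ∀ x : shiftOf w, F ⟨substSeq hh s x.1, substSeq_mem_shiftOf hh hv x.2⟩ = c := by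
  obtain ⟨R, hR⟩ := exists_window (isCompact_shiftOf v) hF.continuous
  -- Radius `R + 1` leaves agreement on radius `R` after one shift.
  obtain ⟨M, hM⟩ := eventually_exists_mem_shiftOf_eqOn v (R + 1)
  choose z hz hzv using fun m => hM (M + m) (Nat.le_add_right _ _)
  have hsub : Set.Icc (-R : ℤ) R ⊆ Set.Icc (-(R + 1 : ℕ) : ℤ) (R + 1 : ℕ) :=
    Set.Icc_subset_Icc (by omega) (by omega)
  have hstep : ∀ m, F ⟨z (m + 1), hz (m + 1)⟩ = F ⟨z m, hz m⟩ + 1 := by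
    intro m
    rw [← hF.map_leftShift ⟨z m, hz m⟩ ⟨_, leftShift_mem_shiftOf (hz m)⟩ rfl]
    refine hR _ _ fun j hj => ?_
    have h1 := hzv (m + 1) (hsub hj)
    have h2 := hzv m (x := j + 1) ⟨by have := hj.1; push_cast; omega,
      by have := hj.2; push_cast; omega⟩
    simp only [leftShift, h1, h2, shiftedExtension]
    congr 1
    omega
  have hall : ∀ m : ℕ, F ⟨z m, hz m⟩ = F ⟨z 0, hz 0⟩ + m := by
    intro m
    induction m with
    | zero => simp
    | succ m ih =>
      rw [hstep, ih]
      push_cast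
      ring
  -- `z t` imitates `v` around position `M + t`; when this is a multiple of `h`, `t` is `-M` modulo
  -- `h`.
  refine ⟨F ⟨z 0, hz 0⟩ - M, fun x => ?_⟩
  obtain ⟨m, hm, hxm⟩ := exists_substSeq_eqOn hh hv x.2 R M
  have hmM : M ≤ m * h := by nlinarith
  obtain ⟨t, ht⟩ := Nat.exists_eq_add_of_le hmM
  have h1 : F ⟨substSeq hh s x.1, substSeq_mem_shiftOf hh hv x.2⟩ = F ⟨z t, hz t⟩ := by
    refine hR _ _ (hxm.trans ?_)
    rw [ht]
    exact ((hzv t).mono hsub).symm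
  have h2 : ((M + t : ℕ) : ZMod h) = 0 := by
    rw [← ht]
    simp
  push_cast at h2
  rw [h1, hall, sub_eq_add_neg, eq_neg_of_add_eq_zero_right h2]

theorem IsHeightFunction.fin_eq_of_iterate_eq [TopologicalSpace α] {F : shiftOf v → ZMod h}
    (hF : IsHeightFunction (shiftOf v) F) {x y : shiftOf v} (hxy : F x = F y) {i j : Fin h}
    (hij : leftShift^[(i : ℕ)] x.1 = leftShift^[(j : ℕ)] y.1) : i = j := by
  have h1 := hF.map_iterate (fun _ => leftShift_mem_shiftOf) i x
    ⟨_, leftShift_iterate_mem (fun _ => leftShift_mem_shiftOf) i x.2⟩ rfl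
  have h2 := hF.map_iterate (fun _ => leftShift_mem_shiftOf) j y
    ⟨_, leftShift_iterate_mem (fun _ => leftShift_mem_shiftOf) i x.2⟩ hij
  rw [h1, hxy, add_right_inj, ZMod.natCast_eq_natCast_iff'] at h2
  rw [Nat.mod_eq_of_lt i.2, Nat.mod_eq_of_lt j.2] at h2
  exact Fin.ext h2

/-- Minimality of a set of two-sided sequences under the shift. -/
def IsShiftMinimal [TopologicalSpace α] (K : Set (ℤ → α)) : Prop :=
  ∀ C : Set (ℤ → α), IsClosed C → C ⊆ K → C.Nonempty → (∀ x ∈ C, leftShift x ∈ C) → C = K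

variable [TopologicalSpace α] [DiscreteTopology α] [Finite α]
  [TopologicalSpace β] [DiscreteTopology β] [Finite β]

/-- The union of the first `h` shifts of the decoded image of `C` is closed, non-empty and
invariant, so minimality makes it everything. -/
theorem IsShiftMinimal.exists_eq_iterate_substSeq (hmin : IsShiftMinimal (shiftOf v)) (hh : 0 < h)
    {s : β → Fin h → α} (hv : ∀ m, v m = s (w (m / h)) ⟨m % h, Nat.mod_lt _ hh⟩)
    {C : Set (ℤ → β)} (hC : IsClosed C) (hCw : C ⊆ shiftOf w) (hCne : C.Nonempty)
    (hCs : ∀ x ∈ C, leftShift x ∈ C) {y : ℤ → α} (hy : y ∈ shiftOf v) :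
    ∃ x ∈ C, ∃ i : Fin h, leftShift^[(i : ℕ)] (substSeq hh s x) = y := by
  have key : (⋃ i : Fin h, (fun x => leftShift^[(i : ℕ)] (substSeq hh s x)) '' C) = shiftOf v := by
    apply hmin
    · refine isClosed_iUnion_of_finite fun i => ?_
      exact (hC.isCompact.image ((continuous_leftShift_iterate _).comp
        (continuous_substSeq hh s))).isClosed
    · refine Set.iUnion_subset fun i => ?_
      rintro _ ⟨x, hx, rfl⟩
      exact leftShift_iterate_mem (fun _ => leftShift_mem_shiftOf) _
        (substSeq_mem_shiftOf hh hv (hCw hx))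
    · obtain ⟨x, hx⟩ := hCne
      exact ⟨_, Set.mem_iUnion.2 ⟨⟨0, hh⟩, x, hx, rfl⟩⟩
    · intro y hy
      obtain ⟨i, x, hx, rfl⟩ := Set.mem_iUnion.1 hy
      simp only [← Function.iterate_succ_apply']
      by_cases hi : (i : ℕ) + 1 < h
      · exact Set.mem_iUnion.2 ⟨⟨i + 1, hi⟩, x, hx, rfl⟩
      · have e : (i : ℕ) + 1 = h := by omega
        -- The last level returns to level 0, since `h` shifts of a decoded point decode one shift
        -- of `x`.
        refine Set.mem_iUnion.2 ⟨⟨0, hh⟩, leftShift x, hCs x hx, ?_⟩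
        simp only [Nat.succ_eq_add_one, e, substSeq_leftShift, Function.iterate_zero, id]
  rw [← key] at hy
  obtain ⟨i, x, hx, rfl⟩ := Set.mem_iUnion.1 hy
  exact ⟨x, hx, i, rfl⟩

/-- The image of `y` is the `i`-th shift of the image of a point of `C`. Constancy of `F` on images
forces `i = 0`, and injectivity of decoding puts `y` in `C`. -/
theorem IsShiftMinimal.of_substSeq (hmin : IsShiftMinimal (shiftOf v)) (hh : 0 < h)
    {F : shiftOf v → ZMod h} (hF : IsHeightFunction (shiftOf v) F)
    {s : β → Fin h → α} (hv : ∀ m, v m = s (w (m / h)) ⟨m % h, Nat.mod_lt _ hh⟩)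
    (hs : Function.Injective s) : IsShiftMinimal (shiftOf w) := by
  intro C hC hCw hCne hCs
  refine Set.Subset.antisymm hCw fun y hy => ?_
  obtain ⟨c, hc⟩ := hF.exists_const hh hv
  obtain ⟨x, hx, i, hi⟩ := hmin.exists_eq_iterate_substSeq hh hv hC hCw hCne hCs
    (substSeq_mem_shiftOf hh hv hy)
  have h0 : i = ⟨0, hh⟩ := hF.fin_eq_of_iterate_eq
    (x := ⟨_, substSeq_mem_shiftOf hh hv (hCw hx)⟩) (y := ⟨_, substSeq_mem_shiftOf hh hv hy⟩)
    ((hc ⟨x, hCw hx⟩).trans (hc ⟨y, hy⟩).symm) hi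
  subst h0
  rwa [← substSeq_injective hh s hs hi]

end HeightFunctions

/-! ## Shifts of directive sequences -/

section Words

variable {α : Type u}

/-- The word of length `l` that occurs in `v` at the index `m`. -/
def wordAt (v : ℕ → α) (m l : ℕ) : List α := List.ofFn fun i : Fin l => v (m + i)

theorem wordAt_length (v : ℕ → α) (m l : ℕ) : (wordAt v m l).length = l := List.length_ofFn

theorem wordAt_getElem (v : ℕ → α) (m l i : ℕ) (hi : i < (wordAt v m l).length) :
    (wordAt v m l)[i] = v (m + i) := List.getElem_ofFn _

theorem wordAt_add (v : ℕ → α) (m a b : ℕ) :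
    wordAt v m (a + b) = wordAt v m a ++ wordAt v (m + a) b := by
  refine List.ext_getElem (by simp [wordAt_length]) fun i h1 h2 => ?_
  rw [List.getElem_append, wordAt_getElem]
  split_ifs with hi
  · rw [wordAt_getElem]
  · rw [wordAt_getElem]
    congr 1
    rw [wordAt_length] at hi ⊢
    omega

theorem infix_wordAt_iff {v : ℕ → α} {m l : ℕ} {w : List α} :
    w <:+: wordAt v m l ↔ ∃ i, i + w.length ≤ l ∧ w = wordAt v (m + i) w.length := by
  constructor
  · rintro ⟨s, t, hst⟩
    have hl := congrArg List.length hst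
    simp only [List.length_append, wordAt_length] at hl
    refine ⟨s.length, by omega, ?_⟩
    refine List.ext_getElem (by simp [wordAt_length]) fun i h1 h2 => ?_
    have h3 : (s ++ w ++ t)[s.length + i]'(by simp; omega) = w[i] := by
      rw [List.getElem_append_left (by simp; omega), List.getElem_append_right (by omega)]
      simp
    rw [← h3, wordAt_getElem]
    simp only [hst, wordAt_getElem]
    congr 1
    omega
  · rintro ⟨i, hi, hw⟩
    refine ⟨wordAt v m i, wordAt v (m + i + w.length) (l - (i + w.length)), ?_⟩
    rw [hw, wordAt_length, ← wordAt_add, add_assoc m, ← wordAt_add]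
    congr 1
    omega

end Words

namespace DirectiveSeq

variable {θ : DirectiveSeq.{u}}

section Language

variable {v : ∀ n, ℕ → θ.A n}

theorem morWord_wordAt (hv : ∀ n, θ.morSeq n (v (n + 1)) = v n) (n m l : ℕ) :
    θ.morWord n (wordAt (v (n + 1)) m l) = wordAt (v n) (m * θ.q n) (l * θ.q n) := by
  induction l with
  | zero => simp [wordAt, morWord]
  | succ l ih =>
    have h1 : wordAt (v (n + 1)) (m + l) 1 = [v (n + 1) (m + l)] := by simp [wordAt]
    rw [wordAt_add, h1, Nat.succ_mul, wordAt_add, ← ih]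
    simp only [morWord, List.flatMap_append, List.flatMap_singleton, List.append_cancel_left_eq]
    refine congrArg List.ofFn (funext fun j => ?_)
    have e : m * θ.q n + l * θ.q n + j = j + θ.q n * (m + l) := by ring
    rw [← hv n, morSeq]
    simp only [e, Nat.add_mul_div_left _ _ (θ.q_pos n), Nat.add_mul_mod_self_left,
      Nat.div_eq_of_lt j.2, Nat.mod_eq_of_lt j.2, zero_add]

theorem comp_wordAt (hv : ∀ n, θ.morSeq n (v (n + 1)) = v n) (n k m l : ℕ) :
    θ.comp n k (wordAt (v (n + k)) m l) =
      wordAt (v n) (m * ∏ i ∈ Finset.range k, θ.q (n + i))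
        (l * ∏ i ∈ Finset.range k, θ.q (n + i)) := by
  induction k generalizing m l with
  | zero => simp [comp]
  | succ k ih =>
    have h1 : θ.comp n (k + 1) (wordAt (v (n + (k + 1))) m l) =
      θ.comp n k (θ.morWord (n + k) (wordAt (v (n + k + 1)) m l)) := rfl
    rw [h1, morWord_wordAt hv, ih, Finset.prod_range_succ]
    congr 1 <;> ring

theorem exists_lt_prod_length (hq : ∀ m, ∃ n, m ≤ n ∧ 1 < θ.q n) (n L : ℕ) :
    ∃ k, 0 < k ∧ L < ∏ i ∈ Finset.range k, θ.q (n + i) := by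
  induction L with
  | zero => exact ⟨1, one_pos, Finset.prod_pos fun i _ => θ.q_pos _⟩
  | succ L ih =>
    obtain ⟨k, hk, hL⟩ := ih
    obtain ⟨m, hm, hqm⟩ := hq (n + k)
    refine ⟨m - n + 1, by omega, ?_⟩
    have h1 : ∏ i ∈ Finset.range k, θ.q (n + i) ≤ ∏ i ∈ Finset.range (m - n), θ.q (n + i) :=
      Finset.prod_le_prod_of_subset_of_one_le' (Finset.range_mono (by omega))
        fun i _ _ => θ.q_pos _
    rw [Finset.prod_range_succ, show n + (m - n) = m by omega]
    nlinarith

/-- Every letter occurs in the limit sequence of its level, so its image words occur in `v n`.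
Conversely, arbitrarily long prefixes of `v n` are images of the single letters `v (n + k) 0`. -/
theorem mem_lang_iff (hv : ∀ n, θ.morSeq n (v (n + 1)) = v n)
    (hsurj : ∀ n, Function.Surjective (v n)) (hq : ∀ m, ∃ n, m ≤ n ∧ 1 < θ.q n) {n : ℕ}
    {w : List (θ.A n)} : w ∈ θ.lang n ↔ ∃ m, w = wordAt (v n) m w.length := by
  have hsing : ∀ k j, θ.comp n k [v (n + k) j] = wordAt (v n)
      (j * ∏ i ∈ Finset.range k, θ.q (n + i)) (∏ i ∈ Finset.range k, θ.q (n + i)) := by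
    intro k j
    have h1 : [v (n + k) j] = wordAt (v (n + k)) j 1 := by simp [wordAt]
    rw [h1, comp_wordAt hv, one_mul]
  constructor
  · rintro ⟨k, -, a, hw⟩
    obtain ⟨j, rfl⟩ := hsurj _ a
    rw [hsing, infix_wordAt_iff] at hw
    obtain ⟨i, -, hi⟩ := hw
    exact ⟨_, hi⟩
  · rintro ⟨m, hm⟩
    obtain ⟨k, hk, hkL⟩ := exists_lt_prod_length hq n (m + w.length)
    refine ⟨k, hk, v (n + k) 0, ?_⟩
    rw [hsing, infix_wordAt_iff]
    exact ⟨m, hkL.le, by rwa [Nat.zero_mul, Nat.zero_add]⟩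

theorem X_eq_shiftOf_of_surjective (hv : ∀ n, θ.morSeq n (v (n + 1)) = v n)
    (hsurj : ∀ n, Function.Surjective (v n)) (hq : ∀ m, ∃ n, m ≤ n ∧ 1 < θ.q n) (n : ℕ) :
    θ.X n = shiftOf (v n) := by
  ext x
  refine forall₂_congr fun k l => ?_
  rw [mem_lang_iff hv hsurj hq]
  refine exists_congr fun m => ?_
  rw [List.length_ofFn, wordAt, List.ofFn_inj, funext_iff]
  exact ⟨fun h i hi => h ⟨i, hi⟩, fun h i => h i i.2⟩

end Language

theorem X_eq_shiftOf_of_isMinimalAt {n : ℕ} (hmin : θ.IsMinimalAt n) {v : ℕ → θ.A n}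
    (hv : v ∈ θ.XOne n) : θ.X n = shiftOf v := by
  refine (hmin.2 _ (isClosed_shiftOf v) (fun x hx k l => ?_) (shiftOf_nonempty v)
    fun x hx => leftShift_mem_shiftOf hx).symm
  obtain ⟨m, hm⟩ := hx k l
  have e : (fun i : Fin l => x (k + (i : ℤ))) = fun i : Fin l => v (m + i) :=
    funext fun i => hm i i.2
  rw [e]
  exact hv m l

/-! ### The limit sequence read in blocks -/

section PureBase

variable {h : ℕ} {u : ∀ n, ℕ → θ.A n}

/-- The sequence `u⁽ⁿ⁾`, read as a sequence of blocks of length `h`. -/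
def blockSeq (θ : DirectiveSeq.{u}) (h : ℕ) (u : ∀ n, ℕ → θ.A n) (hu : θ.IsLimitSequence u)
    (n k : ℕ) : (θ.pureBase h u hu).A n := ⟨fun i : Fin h => u n (k * h + i), k, rfl⟩

/-- The decoding map of the `n`-th alphabet of the pure base. -/
def decode (θ : DirectiveSeq.{u}) (h : ℕ) (u : ∀ n, ℕ → θ.A n) (hu : θ.IsLimitSequence u)
    (n : ℕ) (b : (θ.pureBase h u hu).A n) : Fin h → θ.A n := b.1

theorem decode_injective (hu : θ.IsLimitSequence u) (n : ℕ) :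
    Function.Injective (θ.decode h u hu n) := Subtype.val_injective

theorem blockSeq_surjective (hu : θ.IsLimitSequence u) (n : ℕ) :
    Function.Surjective (θ.blockSeq h u hu n) := by
  rintro ⟨w, k, rfl⟩
  exact ⟨k, rfl⟩

theorem eq_decode_blockSeq (hu : θ.IsLimitSequence u) (hh : 0 < h) (n m : ℕ) :
    u n m = θ.decode h u hu n (θ.blockSeq h u hu n (m / h)) ⟨m % h, Nat.mod_lt _ hh⟩ := by
  simp only [decode, blockSeq]
  rw [Nat.div_add_mod']

theorem morSeq_blockSeq (hu : θ.IsLimitSequence u) (n : ℕ) :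
    (θ.pureBase h u hu).morSeq n (θ.blockSeq h u hu (n + 1)) = θ.blockSeq h u hu n := by
  funext m
  refine Subtype.ext (funext fun i => ?_)
  change θ.subBlock n h (fun i : Fin h => u (n + 1) (m / θ.q n * h + i))
    ⟨m % θ.q n, Nat.mod_lt _ (θ.q_pos n)⟩ i = u n (m * h + i)
  have e : m * h + i = (m % θ.q n * h + i) + θ.q n * (m / θ.q n * h) := by
    conv_lhs => rw [← Nat.div_add_mod m (θ.q n)]
    ring
  have h1 : (m * h + i) / θ.q n = m / θ.q n * h + (m % θ.q n * h + i) / θ.q n := by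
    rw [e, Nat.add_mul_div_left _ _ (θ.q_pos n), Nat.add_comm]
  have h2 : (m * h + i) % θ.q n = (m % θ.q n * h + i) % θ.q n := by
    rw [e, Nat.add_mul_mod_self_left]
  rw [← hu.map_eq n]
  simp only [subBlock, morBlock, morSeq, h1, h2]

theorem X_pureBase (hθ : θ.IsTorsionFree) (hu : θ.IsLimitSequence u) (n : ℕ) :
    (θ.pureBase h u hu).X n = shiftOf (θ.blockSeq h u hu n) :=
  X_eq_shiftOf_of_surjective (morSeq_blockSeq hu) (blockSeq_surjective hu) hθ.length_gt_one n

theorem X_eq_shiftOf (hθ : θ.IsTorsionFree) (hu : θ.IsLimitSequence u) (n : ℕ) :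
    θ.X n = shiftOf (u n) :=
  X_eq_shiftOf_of_isMinimalAt (hθ.minimal n) (hu.mem n)

theorem BoundedAlphabets.pureBase (hθ : θ.BoundedAlphabets) (hu : θ.IsLimitSequence u) :
    (θ.pureBase h u hu).BoundedAlphabets := by
  obtain ⟨C, hC⟩ := hθ
  refine ⟨C ^ h, fun n => ?_⟩
  calc Nat.card (θ.blocks h u n) ≤ Nat.card (Fin h → θ.A n) :=
        Nat.card_le_card_of_injective _ Subtype.val_injective
    _ = Nat.card (θ.A n) ^ h := by rw [Nat.card_fun, Nat.card_fin]
    _ ≤ C ^ h := Nat.pow_le_pow_left (hC n) h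

end PureBase

end DirectiveSeq

/-! ## Suspensions, equicontinuous systems and odometers -/

section Suspension

open Filter Topology Uniformity

variable {X : Type u} {h : ℕ}

theorem suspension_of_lt (T : X → X) (x : X) {i : Fin h} (hi : (i : ℕ) + 1 < h) :
    suspension T h (x, i) = (x, ⟨i + 1, hi⟩) := dif_pos hi

theorem suspension_of_not_lt (T : X → X) (x : X) {i : Fin h} (hi : ¬ (i : ℕ) + 1 < h) :
    suspension T h (x, i) = (T x, ⟨0, lt_of_le_of_lt (Nat.zero_le _) i.2⟩) := dif_neg hi

theorem suspension_iterate (T : X → X) (x : X) (hh : 0 < h) {i : ℕ} (hi : i < h) :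
    (suspension T h)^[i] (x, ⟨0, hh⟩) = (x, ⟨i, hi⟩) := by
  induction i with
  | zero => rfl
  | succ i ih =>
    rw [Function.iterate_succ_apply', ih (by omega), suspension_of_lt T x (by exact hi)]

theorem suspension_iterate_height (T : X → X) (x : X) (hh : 0 < h) :
    (suspension T h)^[h] (x, ⟨0, hh⟩) = (T x, ⟨0, hh⟩) := by
  obtain ⟨k, rfl⟩ := Nat.exists_eq_succ_of_ne_zero hh.ne'
  rw [Function.iterate_succ_apply', suspension_iterate T x hh (Nat.lt_succ_self k),
    suspension_of_not_lt T x (by simp)]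

/-- The inverse of the suspension of a map with inverse `T`. -/
def suspensionInv (T : X → X) (h : ℕ) (p : X × Fin h) : X × Fin h :=
  if (p.2 : ℕ) = 0 then (T p.1, ⟨h - 1, by have := p.2.2; omega⟩)
  else (p.1, ⟨p.2 - 1, by have := p.2.2; omega⟩)

theorem suspensionInv_of_eq_zero (T : X → X) (x : X) {i : Fin h} (hi : (i : ℕ) = 0) :
    suspensionInv T h (x, i) = (T x, ⟨h - 1, by have := i.2; omega⟩) := if_pos hi

theorem suspensionInv_of_ne_zero (T : X → X) (x : X) {i : Fin h} (hi : (i : ℕ) ≠ 0) :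
    suspensionInv T h (x, i) = (x, ⟨i - 1, by have := i.2; omega⟩) := if_neg hi

variable [TopologicalSpace X]

theorem continuous_suspension {T : X → X} (hT : Continuous T) : Continuous (suspension T h) := by
  rw [continuous_prod_of_discrete_right]
  intro i
  by_cases hi : (i : ℕ) + 1 < h
  · simp only [suspension_of_lt T _ hi]
    fun_prop
  · simp only [suspension_of_not_lt T _ hi]
    fun_prop

theorem continuous_suspensionInv {T : X → X} (hT : Continuous T) :
    Continuous (suspensionInv T h) := by
  rw [continuous_prod_of_discrete_right]
  intro i
  by_cases hi : (i : ℕ) = 0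
  · simp only [suspensionInv_of_eq_zero T _ hi]
    exact hT.prodMk continuous_const
  · simp only [suspensionInv_of_ne_zero T _ hi]
    exact continuous_id.prodMk continuous_const

/-- The suspension of a homeomorphism. -/
def suspensionHomeomorph (R : X ≃ₜ X) (h : ℕ) : X × Fin h ≃ₜ X × Fin h where
  toFun := suspension R h
  invFun := suspensionInv R.symm h
  left_inv := by
    rintro ⟨x, i⟩
    by_cases hi : (i : ℕ) + 1 < h
    · simp [suspension_of_lt R x hi, suspensionInv]
    · simp only [suspension_of_not_lt R x hi, suspensionInv, if_true, R.symm_apply_apply]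
      exact Prod.ext rfl (Fin.ext (by have := i.2; simp only; omega))
  right_inv := by
    rintro ⟨x, i⟩
    by_cases hi : (i : ℕ) = 0
    · simp only [suspensionInv, hi, if_true]
      rw [suspension_of_not_lt _ _ (by simp only; omega), R.apply_symm_apply]
      exact Prod.ext rfl (Fin.ext hi.symm)
    · simp only [suspensionInv, hi, if_false]
      rw [suspension_of_lt _ _ (by have := i.2; simp only; omega)]
      exact Prod.ext rfl (Fin.ext (by simp only; omega))
  continuous_toFun := continuous_suspension R.continuous
  continuous_invFun := continuous_suspensionInv R.symm.continuous

/-- The power `m` and the final level `j` depend on `k` and `i` but not on `x`. Two points on one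
level thus stay on a common level, which reduces equicontinuity of the suspension to that of `R`. -/
theorem suspensionHomeomorph_zpow (R : X ≃ₜ X) (k : ℤ) (i : Fin h) :
    ∃ (m : ℤ) (j : Fin h), ∀ x, (suspensionHomeomorph R h ^ k) (x, i) = ((R ^ m) x, j) := by
  induction k generalizing i with
  | zero => exact ⟨0, i, fun x => rfl⟩
  | succ k ih =>
    by_cases hi : (i : ℕ) + 1 < h
    · obtain ⟨m, j, hm⟩ := ih ⟨i + 1, hi⟩
      refine ⟨m, j, fun x => ?_⟩
      rw [← hm, zpow_add_one]
      exact congrArg _ (suspension_of_lt R x hi)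
    · obtain ⟨m, j, hm⟩ := ih ⟨0, lt_of_le_of_lt (Nat.zero_le _) i.2⟩
      refine ⟨m + 1, j, fun x => ?_⟩
      have h1 := hm (R x)
      rw [zpow_add_one, zpow_add_one]
      exact (congrArg _ (suspension_of_not_lt R x hi)).trans h1
  | pred k ih =>
    by_cases hi : (i : ℕ) = 0
    · obtain ⟨m, j, hm⟩ := ih ⟨h - 1, by have := i.2; omega⟩
      refine ⟨m - 1, j, fun x => ?_⟩
      have h1 := hm (R.symm x)
      rw [zpow_sub_one, zpow_sub_one]
      exact (congrArg (suspensionHomeomorph R h ^ (-(k : ℤ))) (suspensionInv_of_eq_zero R.symm x hi)).trans h1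
    · obtain ⟨m, j, hm⟩ := ih ⟨i - 1, by have := i.2; omega⟩
      refine ⟨m, j, fun x => ?_⟩
      rw [← hm, zpow_sub_one]
      exact congrArg (suspensionHomeomorph R h ^ (-(k : ℤ))) (suspensionInv_of_ne_zero R.symm x hi)

theorem IsEquicontinuousSystem.suspension {R : X ≃ₜ X} (hR : IsEquicontinuousSystem R) (h : ℕ) :
    IsEquicontinuousSystem (suspensionHomeomorph R h) := by
  obtain ⟨U, rfl, hU⟩ := hR
  let : UniformSpace (Fin h) := ⊥
  refine ⟨inferInstance, rfl, ?_⟩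
  rintro ⟨x, i⟩ V hV
  obtain ⟨A, hA, B, hB, hAB⟩ := entourageProd_subset hV
  have h1 : ∀ᶠ p : X × Fin h in 𝓝 (x, i), ∀ m : ℤ, ((R ^ m) x, (R ^ m) p.1) ∈ A :=
    (continuous_fst.tendsto (x, i)).eventually (hU x A hA)
  have h2 : ∀ᶠ p : X × Fin h in 𝓝 (x, i), p.2 = i := by
    have : Tendsto (Prod.snd : X × Fin h → Fin h) (𝓝 (x, i)) (𝓝 i) := continuous_snd.continuousAt
    rw [nhds_discrete (Fin h)] at this
    exact tendsto_pure.1 this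
  filter_upwards [h1, h2]
  rintro ⟨y, _⟩ hy rfl k
  obtain ⟨m, j, hm⟩ := suspensionHomeomorph_zpow R k ‹Fin h›
  simp only [hm]
  exact hAB ⟨hy m, refl_mem_uniformity hB⟩

theorem IsFactorMap.suspension {Y : Type v} [TopologicalSpace Y] {T : X → X} {S : Y → Y}
    {π : X → Y} (hπ : IsFactorMap T S π) (h : ℕ) :
    IsFactorMap (suspension T h) (_root_.suspension S h) (Prod.map π id) where
  continuous := hπ.continuous.prodMap continuous_id
  surjective := hπ.surjective.prodMap Function.surjective_id
  equivariant := by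
    rintro ⟨x, i⟩
    by_cases hi : (i : ℕ) + 1 < h
    · rw [suspension_of_lt T x hi]
      exact (suspension_of_lt S (π x) hi).symm
    · rw [suspension_of_not_lt T x hi]
      refine Eq.trans ?_ (suspension_of_not_lt S (π x) hi).symm
      simp [hπ.equivariant]

end Suspension

/-! ### Translations, division by `h`, and the maximal equicontinuous factor of the base -/

section Odometer

open Filter Topology Uniformity

/-- Translations preserve differences, hence every entourage of the group uniformity. -/
theorem isEquicontinuousSystem_addRight {G : Type*} [AddCommGroup G] [TopologicalSpace G]
    [IsTopologicalAddGroup G] (g : G) : IsEquicontinuousSystem (Homeomorph.addRight g) := by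
  have hpow : ∀ (k : ℤ) (x : G), (Homeomorph.addRight g ^ k) x = x + k • g := by
    intro k
    induction k with
    | zero => intro x; simp
    | succ k ih =>
      intro x
      rw [zpow_add_one]
      change (Homeomorph.addRight g ^ (k : ℤ)) (x + g) = _
      rw [ih, add_zsmul, one_zsmul]
      abel
    | pred k ih =>
      intro x
      rw [zpow_sub_one]
      change (Homeomorph.addRight g ^ (-(k : ℤ))) (x + -g) = _
      rw [ih, sub_zsmul, one_zsmul]
      abel
  let := IsTopologicalAddGroup.rightUniformSpace G
  refine ⟨inferInstance, rfl, fun x V hV => ?_⟩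
  rw [uniformity_eq_comap_nhds_zero', Filter.mem_comap] at hV
  obtain ⟨N, hN, hNV⟩ := hV
  have h1 : Tendsto (fun y => y + -x) (𝓝 x) (𝓝 0) := by
    have : Continuous fun y : G => y + -x := by fun_prop
    simpa using this.tendsto x
  filter_upwards [h1 hN] with y hy k
  apply hNV
  simpa [hpow, sub_eq_add_neg] using hy

variable {q : ℕ → ℕ} {h : ℕ}

theorem coprime_partialProd (hq : ∀ n, Nat.Coprime h (q n)) (n : ℕ) :
    Nat.Coprime h (partialProd q n) :=
  Nat.Coprime.prod_right fun i _ => hq i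

/-- Division by `h` in the odometer of `q`, for `h` coprime to every `q n`. -/
def odometerDiv (hq : ∀ n, Nat.Coprime h (q n)) (z : odometer q) : odometer q :=
  ⟨fun n => (h : ZMod (partialProd q n))⁻¹ * z.1 n, fun n => by
    have h1 := ZMod.coe_mul_inv_eq_one h (coprime_partialProd hq (n + 1))
    have h2 := ZMod.coe_mul_inv_eq_one h (coprime_partialProd hq n)
    have h3 := congrArg (ZMod.castHom (partialProd_dvd q n) (ZMod (partialProd q n))) h1
    rw [map_mul, map_one, map_natCast] at h3
    rw [map_mul, z.2 n]
    congr 1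
    calc _ = ((h : ZMod (partialProd q n)) * (h : ZMod (partialProd q n))⁻¹) * _ := by
            rw [h2, one_mul]
      _ = (h : ZMod (partialProd q n))⁻¹ * 1 := by
            rw [← h3]
            ring
      _ = _ := mul_one _⟩

theorem continuous_odometerDiv (hq : ∀ n, Nat.Coprime h (q n)) :
    Continuous (odometerDiv hq) := by
  refine Continuous.subtype_mk (continuous_pi fun n => ?_) _
  exact continuous_const.mul ((continuous_apply n).comp continuous_subtype_val)

theorem odometerDiv_add (hq : ∀ n, Nat.Coprime h (q n)) (y z : odometer q) :
    odometerDiv hq (y + z) = odometerDiv hq y + odometerDiv hq z :=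
  Subtype.ext (funext fun _ => mul_add _ _ _)

theorem odometerDiv_nsmul (hq : ∀ n, Nat.Coprime h (q n)) (z : odometer q) :
    odometerDiv hq (h • z) = z := by
  refine Subtype.ext (funext fun n => ?_)
  have h2 := ZMod.coe_mul_inv_eq_one h (coprime_partialProd hq n)
  change (h : ZMod (partialProd q n))⁻¹ * (h • z.1 n) = z.1 n
  rw [nsmul_eq_mul, ← mul_assoc, mul_comm _ (h : ZMod (partialProd q n)), h2, one_mul]

theorem nsmul_odometerDiv (hq : ∀ n, Nat.Coprime h (q n)) (z : odometer q) :
    h • odometerDiv hq z = z := by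
  refine Subtype.ext (funext fun n => ?_)
  have h2 := ZMod.coe_mul_inv_eq_one h (coprime_partialProd hq n)
  change h • ((h : ZMod (partialProd q n))⁻¹ * z.1 n) = z.1 n
  rw [nsmul_eq_mul, ← mul_assoc, h2, one_mul]

theorem IsFactorMap.map_iterate {X : Type u} [TopologicalSpace X] {T : X → X}
    {π : X → odometer q × ZMod h} (hπ : IsFactorMap T (odometerRotation q h) π) (i : ℕ) (x : X) :
    π (T^[i] x) = π x + (i • odometerOne q, (i : ZMod h)) := by
  induction i with
  | zero => simp
  | succ i ih =>
    rw [Function.iterate_succ_apply', hπ.equivariant, ih]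
    change _ + (odometerOne q, (1 : ZMod h)) = _
    rw [add_assoc, Prod.mk_add_mk, succ_nsmul]
    push_cast
    rfl

/-- If the suspension of `S` of height `h` has the maximal equicontinuous factor
`ℤ_(q_n) × ℤ/hℤ`, with `h` coprime to every `q_n`, then `ℤ_(q_n)` is the maximal equicontinuous
factor of `S`. -/
theorem IsMaximalEquicontinuousFactor.of_suspension {X Y : Type u} [TopologicalSpace X]
    [TopologicalSpace Y] {T : X → X} {S : Y → Y} (hh : 0 < h) (hq : ∀ n, Nat.Coprime h (q n))
    (ψ : Y × Fin h ≃ₜ X) (hψ : ∀ p, ψ (suspension S h p) = T (ψ p))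
    {π : X → odometer q × ZMod h} (hπ : IsMaximalEquicontinuousFactor T (odometerRotation q h) π)
    {c : ZMod h} (hc : ∀ y, (π (ψ (y, ⟨0, hh⟩))).2 = c) :
    IsMaximalEquicontinuousFactor S (odometerRotation q 1)
      fun y => (odometerDiv hq (π (ψ (y, ⟨0, hh⟩))).1, 0) := by
  have hiter : ∀ i p, ψ ((suspension S h)^[i] p) = T^[i] (ψ p) := fun i p =>
    (Function.Semiconj.iterate_right (f := ψ) hψ i) p
  have hS : ∀ y, π (ψ (S y, ⟨0, hh⟩)) = π (ψ (y, ⟨0, hh⟩)) + (h • odometerOne q, (h : ZMod h)) := by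
    intro y
    rw [← suspension_iterate_height S y hh, hiter, hπ.factor.map_iterate]
  have hfac : IsFactorMap S (odometerRotation q 1)
      fun y => (odometerDiv hq (π (ψ (y, ⟨0, hh⟩))).1, (0 : ZMod 1)) := by
    refine ⟨?_, ?_, fun y => ?_⟩
    · refine Continuous.prodMk ((continuous_odometerDiv hq).comp (continuous_fst.comp
        (hπ.factor.continuous.comp (ψ.continuous.comp ?_)))) continuous_const
      fun_prop
    · rintro ⟨z, t⟩
      -- A preimage with second coordinate `c` must lie on level 0, because level `i` has second
      -- coordinate `c + i`.
      obtain ⟨x, hx⟩ := hπ.factor.surjective (h • z, c)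
      obtain ⟨⟨y, i⟩, rfl⟩ := ψ.surjective x
      have h1 : (y, i) = (suspension S h)^[(i : ℕ)] (y, ⟨0, hh⟩) :=
        (suspension_iterate S y hh i.2).symm
      have h2 := congrArg Prod.snd hx
      rw [h1, hiter, hπ.factor.map_iterate, Prod.snd_add, hc] at h2
      simp only [add_eq_left, ZMod.natCast_eq_zero_iff] at h2
      have h3 : i = ⟨0, hh⟩ := Fin.ext (Nat.eq_zero_of_dvd_of_lt h2 i.2)
      refine ⟨y, Prod.ext ?_ (Subsingleton.elim _ _)⟩
      simp only
      rw [← h3, hx, odometerDiv_nsmul]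
    · refine Prod.ext ?_ (Subsingleton.elim _ _)
      simp only [hS, Prod.fst_add, odometerDiv_add, odometerDiv_nsmul]
      rfl
  refine ⟨inferInstance, hfac, isEquicontinuousSystem_addRight _, ?_⟩
  intro W _ _ R ρ hρ hR
  have hρ' : IsFactorMap T (suspensionHomeomorph R h) (Prod.map ρ id ∘ ψ.symm) := by
    have h1 := hρ.suspension h
    refine ⟨h1.continuous.comp ψ.symm.continuous, h1.surjective.comp ψ.symm.surjective, ?_⟩
    intro x
    obtain ⟨p, rfl⟩ := ψ.surjective x
    rw [← hψ]
    simp only [Function.comp_apply, ψ.symm_apply_apply]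
    exact h1.equivariant p
  obtain ⟨g, hg, hgπ⟩ := hπ.maximal (W × Fin h) (suspensionHomeomorph R h) _ hρ' (hR.suspension h)
  have hρg : ∀ y, ρ y = (g (h • odometerDiv hq (π (ψ (y, ⟨0, hh⟩))).1, c)).1 := by
    intro y
    rw [nsmul_odometerDiv, ← hc y, Prod.mk.eta, ← hgπ]
    simp
  -- The factor map is `g` on the fibre over `c`, with the division by `h` undone.
  refine ⟨fun z => (g (h • z.1, c)).1, ⟨?_, ?_, ?_⟩, hρg⟩
  · refine continuous_fst.comp (hg.continuous.comp ?_)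
    fun_prop
  · intro w
    obtain ⟨y, rfl⟩ := hρ.surjective w
    exact ⟨(odometerDiv hq (π (ψ (y, ⟨0, hh⟩))).1, 0), (hρg y).symm⟩
  · intro z
    obtain ⟨y, rfl⟩ := hfac.surjective z
    rw [← hfac.equivariant]
    simp only
    rw [← hρg, ← hρg, hρ.equivariant]

end Odometer

/-! ### The decoded shift as a suspension -/

section Conjugacy

variable {α β : Type u} {h : ℕ} {v : ℕ → α} {w : ℕ → β}
  [TopologicalSpace α] [DiscreteTopology α] [Finite α]
  [TopologicalSpace β] [DiscreteTopology β] [Finite β]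

/-- `F` separates the levels, decoding is injective within a level, and minimality gives
surjectivity; compactness makes the continuous bijection a homeomorphism. -/
theorem IsShiftMinimal.exists_homeomorph_suspension {K : Set (ℤ → α)} {L : Set (ℤ → β)}
    (hK : K = shiftOf v) (hL : L = shiftOf w) (hmin : IsShiftMinimal K) (hh : 0 < h)
    {F : shiftOf v → ZMod h} (hF : IsHeightFunction (shiftOf v) F)
    {s : β → Fin h → α} (hv : ∀ m, v m = s (w (m / h)) ⟨m % h, Nat.mod_lt _ hh⟩)
    (hs : Function.Injective s) :
    ∃ ψ : L × Fin h ≃ₜ K, ∀ p, (ψ p).1 = leftShift^[(p.2 : ℕ)] (substSeq hh s p.1.1) := by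
  subst hK hL
  obtain ⟨c, hc⟩ := hF.exists_const hh hv
  let f : shiftOf w × Fin h → shiftOf v := fun p => ⟨leftShift^[(p.2 : ℕ)] (substSeq hh s p.1.1),
    leftShift_iterate_mem (fun _ => leftShift_mem_shiftOf) _ (substSeq_mem_shiftOf hh hv p.1.2)⟩
  have hf : Continuous f := by
    rw [continuous_prod_of_discrete_right]
    intro i
    exact Continuous.subtype_mk (f := fun x : shiftOf w => leftShift^[(i : ℕ)] (substSeq hh s x.1))
      ((continuous_leftShift_iterate i).comp
        ((continuous_substSeq hh s).comp continuous_subtype_val)) _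
  have hinj : Function.Injective f := by
    rintro ⟨x, i⟩ ⟨y, j⟩ hxy
    have hxy' := congrArg Subtype.val hxy
    have hij : i = j := hF.fin_eq_of_iterate_eq
      (x := ⟨_, substSeq_mem_shiftOf hh hv x.2⟩) (y := ⟨_, substSeq_mem_shiftOf hh hv y.2⟩)
      ((hc x).trans (hc y).symm) hxy'
    subst hij
    exact Prod.ext (Subtype.ext (substSeq_injective hh s hs
      (leftShift_iterate_injective _ hxy'))) rfl
  have hsurj : Function.Surjective f := by
    rintro ⟨y, hy⟩
    obtain ⟨x, hx, i, hi⟩ := hmin.exists_eq_iterate_substSeq hh hv (isClosed_shiftOf w)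
      subset_rfl (shiftOf_nonempty w) (fun _ => leftShift_mem_shiftOf) hy
    exact ⟨(⟨x, hx⟩, i), Subtype.ext hi⟩
  have : CompactSpace (shiftOf w) := isCompact_iff_compactSpace.1 (isCompact_shiftOf w)
  exact ⟨Continuous.homeoOfEquivCompactToT2 (f := Equiv.ofBijective f ⟨hinj, hsurj⟩) hf,
    fun p => rfl⟩

end Conjugacy

/-! ### Application to the pure base -/

namespace DirectiveSeq

variable {θ : DirectiveSeq.{u}} {h : ℕ} {u : ∀ n, ℕ → θ.A n}

theorem isHeightFunction_snd (hθ : θ.IsTorsionFree) (hu : θ.IsLimitSequence u)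
    {π : θ.X 0 → odometer θ.q × ZMod h}
    (hπ : IsFactorMap (θ.shiftMap 0) (odometerRotation θ.q h) π) :
    IsHeightFunction (shiftOf (u 0))
      fun x => (π ⟨x.1, (X_eq_shiftOf hθ hu 0).ge x.2⟩).2 where
  continuous := continuous_snd.comp (hπ.continuous.comp (continuous_subtype_val.subtype_mk _))
  map_leftShift x y hxy := by
    have hX := (X_eq_shiftOf hθ hu 0).ge
    have h1 := hπ.equivariant ⟨x.1, hX x.2⟩
    have h2 : θ.shiftMap 0 ⟨x.1, hX x.2⟩ = ⟨y.1, hX y.2⟩ := Subtype.ext hxy.symm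
    rw [h2] at h1
    exact congrArg Prod.snd h1

theorem HasHeight.exists_isHeightFunction (hθ : θ.IsTorsionFree) (hh : θ.HasHeight h)
    (hu : θ.IsLimitSequence u) (n : ℕ) :
    ∃ F : shiftOf (u n) → ZMod h, IsHeightFunction (shiftOf (u n)) F := by
  obtain ⟨-, hq, π, hπ⟩ := hh
  induction n with
  | zero => exact ⟨_, isHeightFunction_snd hθ hu hπ.factor⟩
  | succ n ih =>
    obtain ⟨F, hF⟩ := ih
    exact ⟨_, hF.pullback (θ.q_pos n) (hq n).symm (s := θ.mor n) (w := u (n + 1))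
      fun m => (congrFun (hu.map_eq n) m).symm⟩

theorem IsTorsionFree.pureBase (hθ : θ.IsTorsionFree) (hh : θ.HasHeight h)
    (hu : θ.IsLimitSequence u) : (θ.pureBase h u hu).IsTorsionFree where
  length_gt_one := hθ.length_gt_one
  prime_dvd := hθ.prime_dvd
  minimal n := by
    obtain ⟨F, hF⟩ := hh.exists_isHeightFunction hθ hu n
    have hmin : IsShiftMinimal (shiftOf (u n)) := by
      rw [← X_eq_shiftOf hθ hu n]
      exact (hθ.minimal n).2
    rw [IsMinimalAt, X_pureBase hθ hu n]
    exact ⟨shiftOf_nonempty _, hmin.of_substSeq hh.1 hF (eq_decode_blockSeq hu hh.1 n)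
      (decode_injective hu n)⟩
  aperiodic x hx k hk hxk := by
    have hpos : 0 < h := hh.1
    rw [X_pureBase hθ hu 0] at hx
    have hDx := substSeq_mem_shiftOf hpos (eq_decode_blockSeq hu hpos 0) hx
    rw [← X_eq_shiftOf hθ hu 0] at hDx
    have hsemi : Function.Semiconj (substSeq hpos (θ.decode h u hu 0)) leftShift leftShift^[h] :=
      substSeq_leftShift hpos _
    -- A period `k` of `x` would give its decoded image the period `h * k`.
    refine hθ.aperiodic _ hDx (h * k) (Nat.mul_pos hpos hk) ?_
    rw [Function.iterate_mul, ← (hsemi.iterate_right k) x, hxk]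

end DirectiveSeq

theorem theorem4p11 (θ : DirectiveSeq.{u}) (hbdd : θ.BoundedAlphabets) (hθ : θ.IsTorsionFree)
    (h : ℕ) (hh : θ.HasHeight h) (u : ∀ n, ℕ → θ.A n) (hu : θ.IsLimitSequence u) :
    (θ.pureBase h u hu).BoundedAlphabets ∧
    (θ.pureBase h u hu).IsTorsionFree ∧
    (θ.pureBase h u hu).HasHeight 1 ∧
    ∃ φ : θ.X 0 ≃ₜ (θ.pureBase h u hu).X 0 × Fin h,
      ∀ x, φ (θ.shiftMap 0 x) = suspension ((θ.pureBase h u hu).shiftMap 0) h (φ x) := by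
  have hpos : 0 < h := hh.1
  have hX := DirectiveSeq.X_eq_shiftOf hθ hu 0
  have hXbar := DirectiveSeq.X_pureBase (h := h) hθ hu 0
  have hv := DirectiveSeq.eq_decode_blockSeq hu hpos 0
  obtain ⟨F, hF⟩ := hh.exists_isHeightFunction hθ hu 0
  obtain ⟨ψ, hψ⟩ := IsShiftMinimal.exists_homeomorph_suspension hX hXbar (hθ.minimal 0).2 hpos hF
    hv (DirectiveSeq.decode_injective hu 0)
  have hconj : ∀ p, ψ (suspension ((θ.pureBase h u hu).shiftMap 0) h p) =
      θ.shiftMap 0 (ψ p) := by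
    rintro ⟨x, i⟩
    refine Subtype.ext ?_
    change _ = leftShift (ψ (x, i)).1
    rw [hψ, hψ, ← Function.iterate_succ_apply' leftShift]
    by_cases hi : (i : ℕ) + 1 < h
    · rw [suspension_of_lt _ _ hi]
    · have e : (i : ℕ).succ = h := by have := i.2; omega
      rw [suspension_of_not_lt _ _ hi, e]
      exact substSeq_leftShift hpos _ x.1
  refine ⟨hbdd.pureBase hu, hθ.pureBase hh hu, ?_, ψ.symm, fun x => ?_⟩
  · obtain ⟨-, hq, π, hπ⟩ := hh
    -- The eigenfunction must be the second coordinate of this very `π`, so that level 0 lies over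
    -- one point `c` of ℤ/h.
    obtain ⟨c, hc⟩ := (DirectiveSeq.isHeightFunction_snd hθ hu hπ.factor).exists_const hpos hv
    refine ⟨one_pos, fun n => Nat.coprime_one_left _, _,
      hπ.of_suspension hpos hq ψ hconj (c := c) fun x => ?_⟩
    rw [← hc ⟨x.1, hXbar.le x.2⟩]
    exact congrArg (fun y => (π y).2) (Subtype.ext (hψ _))
  · obtain ⟨p, rfl⟩ := ψ.surjective x
    rw [← hconj, ψ.symm_apply_apply, ψ.symm_apply_apply]
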